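/- Let $G$ be a permutation group on a non-empty set $\Omega$ (a subgroup of $\mathrm{Sym}(\Omega)$), and let $K$ be a field of characteristic $0$. For $n\ge 0$ let $V_n(G)$ be the $K$-vector space of all functions from the $n$-element subsets of $\Omega$ to $K$ that are invariant under the natural action of $G$ on $n$-element subsets, and let $A(G)=\bigoplus_{n\ge 0}V_n(G)$ be the commutative graded $K$-algebra whose product is given, for $f\in V_m(G)$, $g\in V_n(G)$ and $X\subseteq\Omega$ with $|X|=m+n$, by $$(fg)(X)=\sum_{Y\subseteq X,\ |Y|=m} f(Y)\,g(X\setminus Y).$$ Let $\varepsilon\in V_1(G)$ be the function with $\varepsilon(\{x\})=1$ for all $x\in\Omega$. The group $G$ is *oligomorphic* if for each $n$ it has only finitely many orbits on $n$-element subsets of $\Omega$. It is *wreath-$A$-like* if there are a set $T$ (of "connected blocks"), a weight function $\mathrm{wt}:T\to\{1,2,3,\dots\}$, extended to finite sequences by summing the weights of the terms, and a bijection $\phi$ from the set of orbits of $G$ on finite subsets of $\Omega$ to the set of all finite sequences of elements of $T$ such that, writing $\phi(Y)$ for the value of $\phi$ at the orbit of $Y$, the following hold. (i) $\mathrm{wt}(\phi(Y))=|Y|$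 for every finite $Y\subseteq\Omega$. (ii) If $Y\subseteq\Omega$ is finite and $\phi(Y)=(\Delta_1,\dots,\Delta_k)$, then $Y$ can be partitioned as $Y=Y_1\cup\dots\cup Y_k$ with $|Y_l|=\mathrm{wt}(\Delta_l)$ for each $l$, in such a way that whenever $Z=Z_1\cup\dots\cup Z_k$ with $Z_l\subseteq Y_l$ for each $l$, the sequence $\phi(Z)$ is a concatenation $S_1\oplus\dots\oplus S_k$ of finite sequences with $\mathrm{wt}(S_l)=|Z_l|$ for each $l$, and $S_l=(\Delta_l)$ whenever $Z_l=Y_l$. If $G$ is oligomorphic and wreath-$A$-like, then $\varepsilon$ is a prime element of $A(G)$. -/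

import Mathlib

open scoped Pointwise

/-! ### The graded algebra of a permutation group -/

namespace PermAlgebra

section Components

variable {Ω : Type*} [DecidableEq Ω] (K : Type*) [Field K] (G : Subgroup (Equiv.Perm Ω))

/-- `V_n(G)`: the `K`-vector space of all functions from the `n`-subsets of `Ω` to `K` that are
invariant under the natural action of `G` on `n`-subsets. -/
def V (n : ℕ) : Submodule K (Set.powersetCard Ω n → K) where
  carrier := {f | ∀ (g : G) (X : Set.powersetCard Ω n), f (g • X) = f X}
  add_mem' := by
    intro a b ha hb g X
    simp only [Pi.add_apply, ha g X, hb g X]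
  zero_mem' := fun _ _ => rfl
  smul_mem' := by
    intro c a ha g X
    simp only [Pi.smul_apply, ha g X]

variable {K G}

/-- The value of `f ∈ V_n(G)` at a finite subset `X`, read as `0` if `X` is not an `n`-subset.
This only serves to compare elements of `V_m(G)` and `V_n(G)` for propositionally equal `m, n`. -/
def extend {n : ℕ} (f : V K G n) (X : Finset Ω) : K :=
  if h : X.card = n then f.1 ⟨X, h⟩ else 0

theorem extend_of_card {n : ℕ} (f : V K G n) {X : Finset Ω} (h : X.card = n) :
    extend f X = f.1 ⟨X, h⟩ := dif_pos h

theorem extend_of_card_ne {n : ℕ} (f : V K G n) {X : Finset Ω} (h : X.card ≠ n) :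
    extend f X = 0 := dif_neg h

theorem extend_smul_set {n : ℕ} (f : V K G n) (g : G) (X : Finset Ω) :
    extend f (g • X) = extend f X := by
  by_cases h : X.card = n
  · have h' : (g • X).card = n := by rw [Finset.card_smul_finset]; exact h
    rw [extend_of_card f h, extend_of_card f h']
    exact f.2 g ⟨X, h⟩
  · have h' : (g • X).card ≠ n := by rw [Finset.card_smul_finset]; exact h
    rw [extend_of_card_ne f h, extend_of_card_ne f h']

theorem graded_ext {i j : ℕ} (f : V K G i) (g : V K G j) (hij : i = j)
    (h : ∀ X : Finset Ω, extend f X = extend g X) :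
    GradedMonoid.mk (A := fun n => V K G n) i f = GradedMonoid.mk j g := by
  subst hij
  congr 1
  apply Subtype.ext
  funext X
  have := h X.1
  rwa [extend_of_card f X.2, extend_of_card g X.2] at this

theorem sum_mul_extend_smul {m n : ℕ} (f : V K G m) (g : V K G n) (a : G) (X : Finset Ω) :
    ∑ Y ∈ (a • X).powersetCard m, extend f Y * extend g ((a • X) \ Y) =
      ∑ Y ∈ X.powersetCard m, extend f Y * extend g (X \ Y) := by
  symm
  refine Finset.sum_bij' (fun Y _ => a • Y) (fun Y _ => a⁻¹ • Y) ?_ ?_ ?_ ?_ ?_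
  · intro Y hY
    rw [Finset.mem_powersetCard] at hY ⊢
    exact ⟨Finset.smul_finset_subset_smul_finset_iff.2 hY.1, by
      rw [Finset.card_smul_finset]; exact hY.2⟩
  · intro Y hY
    rw [Finset.mem_powersetCard] at hY ⊢
    refine ⟨?_, by rw [Finset.card_smul_finset]; exact hY.2⟩
    rw [Finset.smul_finset_subset_iff, inv_inv]
    exact hY.1
  · intro Y _
    exact inv_smul_smul a Y
  · intro Y _
    exact smul_inv_smul a Y
  · intro Y _
    rw [extend_smul_set, ← Finset.smul_finset_sdiff, extend_smul_set]

/-- The product of `f ∈ V_m(G)` and `g ∈ V_n(G)`: for each `(m+n)`-subset `X`,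
`(f g)(X) = ∑ f(Y) g(X \ Y)`, summed over the `m`-subsets `Y` of `X`. -/
def mul {m n : ℕ} (f : V K G m) (g : V K G n) : V K G (m + n) :=
  ⟨fun X => ∑ Y ∈ X.1.powersetCard m, extend f Y * extend g (X.1 \ Y), by
    intro a X
    exact sum_mul_extend_smul f g a X.1⟩

theorem extend_mul {m n : ℕ} (f : V K G m) (g : V K G n) (X : Finset Ω) :
    extend (mul f g) X = ∑ Y ∈ X.powerset, extend f Y * extend g (X \ Y) := by
  by_cases h : X.card = m + n
  · rw [extend_of_card _ h]
    change ∑ Y ∈ X.powersetCard m, extend f Y * extend g (X \ Y) = _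
    apply Finset.sum_subset
    · intro Y hY
      exact Finset.mem_powerset.2 (Finset.mem_powersetCard.1 hY).1
    · intro Y hY hY'
      have : Y.card ≠ m := fun hc =>
        hY' (Finset.mem_powersetCard.2 ⟨Finset.mem_powerset.1 hY, hc⟩)
      rw [extend_of_card_ne f this, zero_mul]
  · rw [extend_of_card_ne _ h]
    symm
    apply Finset.sum_eq_zero
    intro Y hY
    have hYX := Finset.mem_powerset.1 hY
    by_cases h1 : Y.card = m
    · have h2 : (X \ Y).card ≠ n := by
        have := Finset.card_sdiff_add_card_eq_card hYX
        omega
      rw [extend_of_card_ne g h2, mul_zero]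
    · rw [extend_of_card_ne f h1, zero_mul]

variable (K G)

/-- The constant functions, as elements of `V_n(G)`. -/
def const (n : ℕ) (c : K) : V K G n := ⟨fun _ => c, fun _ _ => rfl⟩

variable {K G}

theorem extend_const_zero (c : K) (X : Finset Ω) :
    extend (const K G 0 c) X = if X = ∅ then c else 0 := by
  by_cases h : X = ∅
  · rw [extend_of_card _ (Finset.card_eq_zero.2 h), if_pos h]; rfl
  · rw [extend_of_card_ne _ (fun h' => h (Finset.card_eq_zero.1 h')), if_neg h]

theorem extend_const_mul {n : ℕ} (c : K) (f : V K G n) (X : Finset Ω) :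
    extend (mul (const K G 0 c) f) X = c * extend f X := by
  rw [extend_mul, Finset.sum_eq_single ∅]
  · rw [extend_const_zero, if_pos rfl, Finset.sdiff_empty]
  · intro Y _ hY
    rw [extend_const_zero, if_neg hY, zero_mul]
  · intro h
    exact absurd (Finset.empty_mem_powerset X) h

theorem extend_mul_comm {m n : ℕ} (f : V K G m) (g : V K G n) (X : Finset Ω) :
    extend (mul f g) X = extend (mul g f) X := by
  rw [extend_mul, extend_mul]
  refine Finset.sum_bij' (fun Y _ => X \ Y) (fun Y _ => X \ Y) ?_ ?_ ?_ ?_ ?_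
  · intro Y _
    exact Finset.mem_powerset.2 Finset.sdiff_subset
  · intro Y _
    exact Finset.mem_powerset.2 Finset.sdiff_subset
  · intro Y hY
    exact Finset.sdiff_sdiff_eq_self (Finset.mem_powerset.1 hY)
  · intro Y hY
    exact Finset.sdiff_sdiff_eq_self (Finset.mem_powerset.1 hY)
  · intro Y hY
    rw [Finset.sdiff_sdiff_eq_self (Finset.mem_powerset.1 hY), mul_comm]

theorem extend_mul_assoc {l m n : ℕ} (f : V K G l) (g : V K G m) (h : V K G n) (X : Finset Ω) :
    extend (mul (mul f g) h) X = extend (mul f (mul g h)) X := by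
  rw [extend_mul, extend_mul]
  simp only [extend_mul, Finset.sum_mul, Finset.mul_sum]
  rw [Finset.sum_sigma', Finset.sum_sigma']
  refine Finset.sum_bij' (fun p _ => ⟨p.2, p.1 \ p.2⟩) (fun p _ => ⟨p.1 ∪ p.2, p.1⟩) ?_ ?_ ?_ ?_ ?_
  · rintro ⟨Y, W⟩ hp
    simp only [Finset.mem_sigma, Finset.mem_powerset] at hp ⊢
    exact ⟨hp.2.trans hp.1, Finset.sdiff_subset_sdiff hp.1 le_rfl⟩
  · rintro ⟨W, U⟩ hp
    simp only [Finset.mem_sigma, Finset.mem_powerset] at hp ⊢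
    exact ⟨Finset.union_subset hp.1 (hp.2.trans Finset.sdiff_subset), Finset.subset_union_left⟩
  · rintro ⟨Y, W⟩ hp
    simp only [Finset.mem_sigma, Finset.mem_powerset] at hp
    simp only [Finset.union_sdiff_of_subset hp.2]
  · rintro ⟨W, U⟩ hp
    simp only [Finset.mem_sigma, Finset.mem_powerset] at hp
    have hd : Disjoint U W := Finset.disjoint_of_subset_left hp.2 Finset.sdiff_disjoint
    simp only [Finset.union_sdiff_cancel_left hd.symm]
  · rintro ⟨Y, W⟩ hp
    simp only [Finset.mem_sigma, Finset.mem_powerset] at hp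
    have : (X \ W) \ (Y \ W) = X \ Y := by
      ext x
      simp only [Finset.mem_sdiff]
      have := @hp.2 x
      tauto
    rw [this, mul_assoc]

theorem extend_zero {n : ℕ} (X : Finset Ω) : extend (0 : V K G n) X = 0 := by
  unfold extend; split_ifs <;> rfl

theorem extend_add {n : ℕ} (f g : V K G n) (X : Finset Ω) :
    extend (f + g) X = extend f X + extend g X := by
  unfold extend; split_ifs
  · rfl
  · rw [add_zero]

theorem extend_smul {n : ℕ} (c : K) (f : V K G n) (X : Finset Ω) :
    extend (c • f) X = c * extend f X := by
  unfold extend; split_ifs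
  · rfl
  · rw [mul_zero]

theorem V_ext {n : ℕ} {f g : V K G n} (h : ∀ X : Finset Ω, extend f X = extend g X) : f = g := by
  apply Subtype.ext
  funext X
  have := h X.1
  rwa [extend_of_card f X.2, extend_of_card g X.2] at this

instance instGOne : GradedMonoid.GOne (fun n => V K G n) := ⟨const K G 0 1⟩

instance instGMul : GradedMonoid.GMul (fun n => V K G n) := ⟨fun f g => mul f g⟩

instance instGCommRing : DirectSum.GCommRing (fun n => V K G n) where
  mul_zero a := V_ext fun X => (extend_mul _ _ X).trans <| by simp [extend_zero]
  zero_mul a := V_ext fun X => (extend_mul _ _ X).trans <| by simp [extend_zero]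
  mul_add a b c := V_ext fun X => (extend_mul _ _ X).trans <| by
    rw [extend_add]
    erw [extend_mul, extend_mul]
    simp [extend_add, mul_add, Finset.sum_add_distrib]
  add_mul a b c := V_ext fun X => (extend_mul _ _ X).trans <| by
    rw [extend_add]
    erw [extend_mul, extend_mul]
    simp [extend_add, add_mul, Finset.sum_add_distrib]
  one_mul := fun ⟨n, f⟩ => graded_ext _ f (zero_add n) fun X =>
    (extend_const_mul 1 f X).trans (one_mul _)
  mul_one := fun ⟨n, f⟩ => graded_ext _ f (add_zero n) fun X =>
    (extend_mul_comm f (const K G 0 1) X).trans ((extend_const_mul 1 f X).trans (one_mul _))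
  mul_assoc := fun ⟨_, f⟩ ⟨_, g⟩ ⟨_, h⟩ => graded_ext _ _ (add_assoc _ _ _) fun X =>
    extend_mul_assoc f g h X
  mul_comm := fun ⟨_, f⟩ ⟨_, g⟩ => graded_ext _ _ (add_comm _ _) fun X => extend_mul_comm f g X
  natCast n := const K G 0 n
  natCast_zero := Subtype.ext (funext fun _ => Nat.cast_zero)
  natCast_succ n := Subtype.ext (funext fun _ => Nat.cast_succ n)
  intCast n := const K G 0 n
  intCast_ofNat n := Subtype.ext (funext fun _ => Int.cast_natCast n)
  intCast_negSucc_ofNat n := Subtype.ext (funext fun _ => Int.cast_negSucc n)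

instance instGAlgebra : DirectSum.GAlgebra K (fun n => V K G n) where
  toFun :=
    { toFun := fun c => const K G 0 c
      map_zero' := rfl
      map_add' := fun _ _ => rfl }
  map_one := rfl
  map_mul r s := graded_ext _ _ rfl fun X => by
    refine Eq.trans ?_ (extend_const_mul r (const K G 0 s) X).symm
    change extend (const K G 0 (r * s)) X = _
    rw [extend_const_zero, extend_const_zero]
    split_ifs <;> simp
  commutes r := fun ⟨_, f⟩ => graded_ext _ _ (add_comm _ _) fun X =>
    extend_mul_comm (const K G 0 r) f X
  smul_def r := fun ⟨n, f⟩ => graded_ext (r • f) (mul (const K G 0 r) f) (zero_add n).symm fun X => by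
    rw [extend_const_mul, extend_smul]

variable (K G)

/-- The graded algebra `A(G) = ⨁ n, V_n(G)`; its (commutative) multiplication is the bilinear
extension of `PermAlgebra.mul`, by the instances `instGCommRing` and `instGAlgebra`. -/
abbrev A : Type _ := DirectSum ℕ (fun n => V K G n)

/-- The element `ε` of `A(G)`: the function in `V_1(G)` with `ε(x) = 1` for all `x ∈ Ω`. -/
def ε : A K G := DirectSum.of (fun n => V K G n) 1 (const K G 1 1)

end Components

/-! ### Oligomorphic and wreath-`A`-like permutation groups -/

/-- `G` is oligomorphic if it has only finitely many orbits on `n`-subsets, for each `n`. -/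
def IsOligomorphic {Ω : Type*} [DecidableEq Ω] (G : Subgroup (Equiv.Perm Ω)) : Prop :=
  ∀ n : ℕ, Finite (MulAction.orbitRel.Quotient G (Set.powersetCard Ω n))

/-- The orbit of a finite subset `Y` of `Ω` under `G`. -/
def orbitOf {Ω : Type*} [DecidableEq Ω] (G : Subgroup (Equiv.Perm Ω)) (Y : Finset Ω) :
    MulAction.orbitRel.Quotient G (Finset Ω) :=
  Quotient.mk (MulAction.orbitRel G (Finset Ω)) Y

/-- The weight of a finite sequence of connected blocks. -/
def seqWeight {B : Type*} (wt : B → ℕ) (S : List B) : ℕ := (S.map wt).sum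

/-- The data exhibiting `G` as wreath-`A`-like with set of connected blocks `B`. -/
structure WreathALikeData {Ω : Type*} [DecidableEq Ω] (G : Subgroup (Equiv.Perm Ω))
    (B : Type*) where
  /-- the weight of a connected block -/
  wt : B → ℕ
  wt_pos : ∀ b, 0 < wt b
  /-- the bijection from orbits on finite subsets to finite sequences of connected blocks -/
  φ : MulAction.orbitRel.Quotient G (Finset Ω) ≃ List B
  /-- condition (i) -/
  weight_eq : ∀ Y : Finset Ω, seqWeight wt (φ (orbitOf G Y)) = Y.card
  /-- condition (ii) -/
  decomp : ∀ (Y : Finset Ω) (α : List B), φ (orbitOf G Y) = α →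
    ∃ P : Fin α.length → Finset Ω,
      Pairwise (fun l l' => Disjoint (P l) (P l')) ∧
      Finset.univ.biUnion P = Y ∧
      (∀ l, (P l).card = wt (α.get l)) ∧
      ∀ Z : Fin α.length → Finset Ω, (∀ l, Z l ⊆ P l) →
        ∃ S : Fin α.length → List B,
          φ (orbitOf G (Finset.univ.biUnion Z)) = (List.ofFn S).flatten ∧
          (∀ l, seqWeight wt (S l) = (Z l).card) ∧
          ∀ l, Z l = P l → S l = [α.get l]

/-- `G` is wreath-`A`-like. (The connected blocks embed into the orbits on finite subsets, so
nothing is lost by taking them in the universe of `Ω`.) -/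
def IsWreathALike.{u} {Ω : Type u} [DecidableEq Ω] (G : Subgroup (Equiv.Perm Ω)) : Prop :=
  ∃ B : Type u, Nonempty (WreathALikeData G B)

end PermAlgebra

/-! Through `φ`, an element of A(G) becomes a function on words in the connected blocks that
vanishes on words of large weight. Splitting a finite set along its blocks splits its word into
complementary subwords, while any other splitting cuts a block and so produces more letters in total
(`exists_blocks`). Hence, when A(G) is filtered by word length, leading parts multiply by the
shuffle product (`series_mul_apply`), and ε is the sum of the letters of weight one.

In the shuffle algebra, `del b` is a derivation, and it sends ε to 1 when b is a letter of weight
one. In characteristic 0 every series of bounded length is congruent modulo ε to one killed by `del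
b` (`exists_del_sub_mul_eq_zero`), but no nonzero multiple of ε is killed
(`eq_zero_of_mul_eq_zero`). If ε divides fg, replace both factors by such representatives: their
product is a multiple of ε killed by `del b`, so it is 0, and one of them is 0 because series of
bounded length have no zero divisors (`mul_ne_zero_of_lengthLT`).

This passes to A(G) by descent: if ε divides ab there, it divides one of the two leading parts, and
subtracting a multiple of ε shortens that factor (`ε_dvd_or_dvd`). -/

/-! ### Shuffle series -/

/-- Functions on words in the alphabet `B`, to be multiplied by the shuffle product. -/
def ShuffleSeries (B K : Type*) : Type _ := List B → K

namespace ShuffleSeries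

@[ext]
theorem ext {B K : Type*} {f g : ShuffleSeries B K} (h : ∀ w, f w = g w) : f = g := funext h

/-! ### The shuffle algebra and its length filtration. -/

section Ring

variable {B K : Type*} [Field K]

instance : AddCommGroup (ShuffleSeries B K) := inferInstanceAs (AddCommGroup (List B → K))

instance : Module K (ShuffleSeries B K) := inferInstanceAs (Module K (List B → K))

/-- Deletion of the first letter `b`. -/
def del (b : B) : ShuffleSeries B K →ₗ[K] ShuffleSeries B K where
  toFun f := fun w => f (b :: w)
  map_add' _ _ := rfl
  map_smul' _ _ := rfl

theorem del_apply (b : B) (f : ShuffleSeries B K) (w : List B) : del b f w = f (b :: w) := rfl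

theorem add_apply (f g : ShuffleSeries B K) (w : List B) : (f + g) w = f w + g w := rfl

theorem sub_apply (f g : ShuffleSeries B K) (w : List B) : (f - g) w = f w - g w := rfl

theorem zero_apply (w : List B) : (0 : ShuffleSeries B K) w = 0 := rfl

theorem smul_apply (c : K) (f : ShuffleSeries B K) (w : List B) : (c • f) w = c * f w := rfl

/-- The shuffle product. -/
def shuffle : ShuffleSeries B K → ShuffleSeries B K → List B → K
  | f, g, [] => f [] * g []
  | f, g, b :: w => shuffle (del b f) g w + shuffle f (del b g) w

instance : Mul (ShuffleSeries B K) := ⟨shuffle⟩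

/-- The indicator function of the empty word. -/
def unit : List B → K
  | [] => 1
  | _ :: _ => 0

instance : One (ShuffleSeries B K) := ⟨unit⟩

theorem mul_nil (f g : ShuffleSeries B K) : (f * g) [] = f [] * g [] := by
  change shuffle f g [] = _
  rw [shuffle]

theorem mul_cons (f g : ShuffleSeries B K) (b : B) (w : List B) :
    (f * g) (b :: w) = (del b f * g) w + (f * del b g) w := by
  change shuffle f g (b :: w) = _
  rw [shuffle]
  rfl

theorem one_nil : (1 : ShuffleSeries B K) [] = 1 := rfl

theorem one_cons (b : B) (w : List B) : (1 : ShuffleSeries B K) (b :: w) = 0 := rfl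

theorem del_mul (b : B) (f g : ShuffleSeries B K) :
    del b (f * g) = del b f * g + f * del b g :=
  ext fun w => mul_cons f g b w

theorem del_one (b : B) : del b (1 : ShuffleSeries B K) = 0 := rfl

theorem add_mul_apply (w : List B) (f g h : ShuffleSeries B K) :
    ((f + g) * h) w = (f * h) w + (g * h) w := by
  induction w generalizing f g h with
  | nil => simp only [mul_nil, add_apply, add_mul]
  | cons b w ih => simp only [mul_cons, map_add, ih]; ring

theorem mul_comm_apply (w : List B) (f g : ShuffleSeries B K) : (f * g) w = (g * f) w := by
  induction w generalizing f g with
  | nil => simp only [mul_nil, mul_comm]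
  | cons b w ih => rw [mul_cons, mul_cons, ih, ih f, add_comm]

theorem mul_add_apply (w : List B) (f g h : ShuffleSeries B K) :
    (f * (g + h)) w = (f * g) w + (f * h) w := by
  rw [mul_comm_apply, add_mul_apply, mul_comm_apply w f, mul_comm_apply w f]

theorem mul_assoc_apply (w : List B) (f g h : ShuffleSeries B K) :
    (f * g * h) w = (f * (g * h)) w := by
  induction w generalizing f g h with
  | nil => simp only [mul_nil, mul_assoc]
  | cons b w ih =>
    rw [mul_cons, mul_cons, del_mul, del_mul, add_mul_apply, mul_add_apply, ih, ih, ih, add_assoc]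

theorem smul_mul_apply (w : List B) (c : K) (f g : ShuffleSeries B K) :
    ((c • f) * g) w = c * (f * g) w := by
  induction w generalizing f g with
  | nil => simp only [mul_nil, smul_apply, mul_assoc]
  | cons b w ih => simp only [mul_cons, map_smul, ih, mul_add]

theorem zero_mul_apply (w : List B) (f : ShuffleSeries B K) : ((0 : ShuffleSeries B K) * f) w = 0 := by
  have := smul_mul_apply w 0 f f
  rwa [zero_smul, zero_mul] at this

theorem one_mul_apply (w : List B) (f : ShuffleSeries B K) : (1 * f) w = f w := by
  induction w generalizing f with
  | nil => rw [mul_nil, one_nil, one_mul]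
  | cons b w ih => rw [mul_cons, del_one, zero_mul_apply, zero_add, ih, del_apply]

instance : CommRing (ShuffleSeries B K) where
  __ := (inferInstance : AddCommGroup (ShuffleSeries B K))
  __ := (inferInstance : Mul (ShuffleSeries B K))
  __ := (inferInstance : One (ShuffleSeries B K))
  left_distrib f g h := ext fun w => mul_add_apply w f g h
  right_distrib f g h := ext fun w => add_mul_apply w f g h
  zero_mul f := ext fun w => zero_mul_apply w f
  mul_zero f := ext fun w => (mul_comm_apply w f 0).trans (zero_mul_apply w f)
  mul_assoc f g h := ext fun w => mul_assoc_apply w f g h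
  one_mul f := ext fun w => one_mul_apply w f
  mul_one f := ext fun w => (mul_comm_apply w f 1).trans (one_mul_apply w f)
  mul_comm f g := ext fun w => mul_comm_apply w f g

instance : Algebra K (ShuffleSeries B K) :=
  Algebra.ofModule (fun c f g => ext fun w => smul_mul_apply w c f g) fun c f g => by
    rw [mul_comm, mul_comm f g]
    exact ext fun w => smul_mul_apply w c g f

/-- Only pairs of complementary subwords of w enter the shuffle product at w. Remembering them
merely up to permutation is enough, since later arguments use only length and weight, which do not
see the order of letters. -/
theorem mul_apply_congr {w : List B} {f g f' g' : ShuffleSeries B K}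
    (h : ∀ u v : List B, (u ++ v).Perm w → f u * g v = f' u * g' v) :
    (f * g) w = (f' * g') w := by
  induction w generalizing f g f' g' with
  | nil => rw [mul_nil, mul_nil]; exact h [] [] (List.Perm.refl _)
  | cons b w ih =>
    rw [mul_cons, mul_cons]
    congr 1
    · exact ih fun u v huv => h (b :: u) v (huv.cons b)
    · exact ih fun u v huv => h u (b :: v) (List.perm_middle.trans (huv.cons b))

/-- The shuffle product as a sum over all ways to split a word into two complementary subwords. -/
theorem mul_apply_eq_sum (w : List B) (f g : ShuffleSeries B K) :
    (f * g) w = ∑ c : Fin w.length → Bool,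
      f (List.ofFn fun l => if c l then [w.get l] else []).flatten *
        g (List.ofFn fun l => if c l then [] else [w.get l]).flatten := by
  induction w generalizing f g with
  | nil => simp [mul_nil]
  | cons b w ih =>
    rw [mul_cons, ih, ih]
    change _ = ∑ c : Fin (w.length + 1) → Bool, _
    rw [← (Fin.consEquiv fun _ : Fin (w.length + 1) => Bool).sum_comp, Fintype.sum_prod_type,
      Fintype.sum_bool]
    congr 1 <;> simp [List.ofFn_succ, del_apply]

/-- The series supported on words of length less than `p`. -/
def LengthLT (f : ShuffleSeries B K) (p : ℕ) : Prop := ∀ w : List B, p ≤ w.length → f w = 0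

theorem LengthLT.mono {f : ShuffleSeries B K} {p q : ℕ} (hf : f.LengthLT p) (hpq : p ≤ q) :
    f.LengthLT q := fun w hw => hf w (hpq.trans hw)

theorem LengthLT.eq_zero {f : ShuffleSeries B K} (hf : f.LengthLT 0) : f = 0 :=
  ext fun w => hf w (Nat.zero_le _)

theorem LengthLT.del {f : ShuffleSeries B K} {p : ℕ} (hf : f.LengthLT (p + 1)) (b : B) :
    (del b f).LengthLT p := fun w hw => hf (b :: w) (Nat.succ_le_succ hw)

theorem LengthLT.sub {f g : ShuffleSeries B K} {p : ℕ} (hf : f.LengthLT p) (hg : g.LengthLT p) :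
    (f - g).LengthLT p := fun w hw => by rw [sub_apply, hf w hw, hg w hw, sub_zero]

theorem LengthLT.smul {f : ShuffleSeries B K} {p : ℕ} (hf : f.LengthLT p) (c : K) :
    (c • f).LengthLT p := fun w hw => by rw [smul_apply, hf w hw, mul_zero]

theorem LengthLT.mul {f g : ShuffleSeries B K} {p q : ℕ} (hf : f.LengthLT (p + 1))
    (hg : g.LengthLT (q + 1)) : (f * g).LengthLT (p + q + 1) := fun w hw => by
  rw [← zero_mul_apply w 0]
  refine mul_apply_congr fun u v huv => ?_
  have := huv.length_eq
  rw [List.length_append] at this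
  rw [zero_apply, zero_mul]
  by_cases hu : p + 1 ≤ u.length
  · rw [hf u hu, zero_mul]
  · rw [hg v (by omega), mul_zero]

/-- The part of a series supported on words of length `p`. -/
def lengthPart (p : ℕ) (f : ShuffleSeries B K) : ShuffleSeries B K :=
  fun w => if w.length = p then f w else 0

theorem lengthPart_apply (p : ℕ) (f : ShuffleSeries B K) (w : List B) :
    lengthPart p f w = if w.length = p then f w else 0 := rfl

theorem lengthLT_lengthPart (p : ℕ) (f : ShuffleSeries B K) :
    (lengthPart p f).LengthLT (p + 1) := fun w hw => if_neg (by omega)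

/-- Lengths add under shuffling, so only the two top parts can contribute in the top length p + q.
-/
theorem lengthPart_mul_lengthPart {f g : ShuffleSeries B K} {p q : ℕ} (hf : f.LengthLT (p + 1))
    (hg : g.LengthLT (q + 1)) :
    lengthPart p f * lengthPart q g = lengthPart (p + q) (f * g) := by
  ext w
  rw [lengthPart_apply]
  split_ifs with hw
  · refine mul_apply_congr fun u v huv => ?_
    have := huv.length_eq
    rw [List.length_append] at this
    rw [lengthPart_apply, lengthPart_apply]
    by_cases hu : u.length = p
    · rw [if_pos hu, if_pos (by omega)]
    · rw [if_neg hu, zero_mul]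
      by_cases hu' : p + 1 ≤ u.length
      · rw [hf u hu', zero_mul]
      · rw [hg v (by omega), mul_zero]
  · rw [← zero_mul_apply w 0]
    refine mul_apply_congr fun u v huv => ?_
    have := huv.length_eq
    rw [List.length_append] at this
    rw [lengthPart_apply, lengthPart_apply, zero_apply, zero_mul]
    by_cases hu : u.length = p
    · rw [if_neg (by omega : ¬ v.length = q), mul_zero]
    · rw [if_neg hu, zero_mul]

end Ring

/-! ### Absence of zero divisors, and primality of a sum of letters. -/

section Prime

variable {B K : Type*} [Field K]

/-- The leading case of the Leibniz rule for iterated deletions. -/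
theorem iterate_del_mul (b : B) (i j : ℕ) (f g : ShuffleSeries B K)
    (hf : (del b)^[i + 1] f = 0) (hg : (del b)^[j + 1] g = 0) :
    (del b)^[i + j] (f * g) = ((i + j).choose i : K) • ((del b)^[i] f * (del b)^[j] g) := by
  have key : ∀ n i j : ℕ, i + j = n → ∀ f g : ShuffleSeries B K,
      (del b)^[i + 1] f = 0 → (del b)^[j + 1] g = 0 →
      (del b)^[n] (f * g) = (n.choose i : K) • ((del b)^[i] f * (del b)^[j] g) := by
    intro n
    induction n with
    | zero =>
      intro i j hij f g _ _
      obtain ⟨rfl, rfl⟩ : i = 0 ∧ j = 0 := by omega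
      simp
    | succ n ih =>
      intro i j hij f g hf hg
      rw [Function.iterate_succ_apply, del_mul, iterate_map_add]
      -- At a boundary (i = 0 or j = 0) one Leibniz term dies and the coefficient is 1; otherwise
      -- the two terms combine by Pascal's rule.
      rcases i with _ | i
      · have hf' : del b f = 0 := hf
        obtain rfl : j = n + 1 := by omega
        rw [hf', zero_mul, iterate_map_zero, zero_add, ih 0 n (by omega) f (del b g) hf hg]
        simp
      · rcases j with _ | j
        · have hg' : del b g = 0 := hg
          obtain rfl : i = n := by omega
          rw [hg', mul_zero, iterate_map_zero, add_zero, ih i 0 (by omega) (del b f) g hf hg]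
          simp
        · rw [ih i (j + 1) (by omega) (del b f) g hf hg, ih (i + 1) j (by omega) f (del b g) hf hg,
            ← Function.iterate_succ_apply, ← Function.iterate_succ_apply, ← add_smul,
            Nat.choose_succ_succ, Nat.cast_add]
  exact key _ i j rfl f g hf hg

theorem LengthLT.iterate_del {f : ShuffleSeries B K} {p : ℕ} (b : B) (i : ℕ)
    (hf : f.LengthLT (p + i)) : ((ShuffleSeries.del b)^[i] f).LengthLT p := by
  induction i generalizing f with
  | zero => exact hf
  | succ i ih => exact ih (LengthLT.del hf b)

/-- The order of nilpotency of `del b` at a nonzero series of bounded length. -/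
theorem exists_iterate_del {f : ShuffleSeries B K} {p : ℕ} (hf : f.LengthLT p) (h0 : f ≠ 0)
    (b : B) : ∃ i < p, (del b)^[i] f ≠ 0 ∧ (del b)^[i + 1] f = 0 := by
  induction p generalizing f with
  | zero => exact absurd hf.eq_zero h0
  | succ p ih =>
    by_cases h : del b f = 0
    · exact ⟨0, Nat.succ_pos _, h0, h⟩
    · obtain ⟨i, hi, h1, h2⟩ := ih (hf.del b) h
      exact ⟨i + 1, Nat.succ_lt_succ hi, h1, h2⟩

/-- Differentiate each factor by the same letter as often as possible without killing it. By
Leibniz, the product of the results is, up to a nonzero binomial coefficient, a derivative of fg,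
and its factors are shorter. If every letter kills both factors, they are constants. -/
theorem mul_ne_zero_of_lengthLT [CharZero K] {f g : ShuffleSeries B K} {p q : ℕ}
    (hf : f.LengthLT p) (hg : g.LengthLT q) (hf0 : f ≠ 0) (hg0 : g ≠ 0) : f * g ≠ 0 := by
  induction hn : p + q using Nat.strong_induction_on generalizing f g p q with
  | _ n ih =>
  by_cases hb : ∃ b : B, del b f ≠ 0 ∨ del b g ≠ 0
  · obtain ⟨b, hb⟩ := hb
    obtain ⟨i, hip, hi, hi'⟩ := exists_iterate_del hf hf0 b
    obtain ⟨j, hjq, hj, hj'⟩ := exists_iterate_del hg hg0 b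
    -- At least one factor is really differentiated, so the sum of the length bounds drops.
    have hij : 0 < i + j := by
      by_contra hcon
      obtain ⟨rfl, rfl⟩ : i = 0 ∧ j = 0 := by omega
      exact hb.elim (fun h => h hi') fun h => h hj'
    have h1 := iterate_del_mul b i j f g hi' hj'
    intro h0
    rw [h0, iterate_map_zero] at h1
    have hc : ((i + j).choose i : K) ≠ 0 :=
      Nat.cast_ne_zero.2 (Nat.choose_pos (Nat.le_add_right i j)).ne'
    refine ih ((p - i) + (q - j)) (by omega) (p := p - i) (q := q - j) ?_ ?_ hi hj rfl
      ((smul_eq_zero.1 h1.symm).resolve_left hc)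
    · exact LengthLT.iterate_del b i (hf.mono (by omega))
    · exact LengthLT.iterate_del b j (hg.mono (by omega))
  · push Not at hb
    have hnil : ∀ {h : ShuffleSeries B K}, h ≠ 0 → (∀ b, del b h = 0) → h [] ≠ 0 := by
      intro h h0 hd hn
      refine h0 (ext fun w => ?_)
      rcases w with _ | ⟨b, w⟩
      · exact hn
      · exact congrFun (hd b) w
    intro h0
    have := mul_nil f g
    rw [h0] at this
    exact mul_ne_zero (hnil hf0 fun b => (hb b).1) (hnil hg0 fun b => (hb b).2) this.symm

variable {e : ShuffleSeries B K} {b : B}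

/-- Applying `del b` gives the same equation for `del b h` with c + 1 in place of c, which is why c
is general. Since e lives on letters, e * `del b h` at a word sees `del b h` only on words one
letter shorter, so induction on length applies. -/
theorem eq_zero_of_smul_add_mul_del [CharZero K] (he : ∀ w, e w ≠ 0 → w.length = 1) (c : ℕ)
    (hc : c ≠ 0) (hb : del b e = 1) {h : ShuffleSeries B K}
    (hh : (c : K) • h + e * del b h = 0) : h = 0 := by
  have key : ∀ n c : ℕ, c ≠ 0 → ∀ h : ShuffleSeries B K, (c : K) • h + e * del b h = 0 →
      ∀ w : List B, w.length = n → h w = 0 := by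
    intro n
    induction n with
    | zero =>
      intro c hc h hh w hw
      obtain rfl := List.length_eq_zero_iff.1 hw
      have h1 := congrFun hh []
      have he0 : e [] = 0 := by
        by_contra h0
        exact absurd (he _ h0) (by simp)
      change (c : K) * h [] + (e * del b h) [] = 0 at h1
      rw [mul_nil, he0, zero_mul, add_zero] at h1
      exact (mul_eq_zero.1 h1).resolve_left (Nat.cast_ne_zero.2 hc)
    | succ n ih =>
      intro c hc h hh w hw
      have h1 : ((c + 1 : ℕ) : K) • del b h + e * del b (del b h) = 0 := by
        have := congrArg (del b) hh
        rw [map_add, map_smul, del_mul, hb, one_mul, map_zero] at this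
        rw [Nat.cast_add, Nat.cast_one, add_smul, one_smul, add_assoc]
        exact this
      have h2 : (e * del b h) w = 0 := by
        rw [← zero_mul_apply w 0]
        refine mul_apply_congr fun u v huv => ?_
        rw [zero_apply, zero_mul]
        by_cases hu : e u = 0
        · rw [hu, zero_mul]
        · have h3 := he u hu
          have h4 := huv.length_eq
          rw [List.length_append] at h4
          rw [ih (c + 1) (Nat.succ_ne_zero c) _ h1 v (by omega), mul_zero]
      have h3 := congrFun hh w
      change (c : K) * h w + (e * del b h) w = 0 at h3
      rw [h2, add_zero] at h3
      exact (mul_eq_zero.1 h3).resolve_left (Nat.cast_ne_zero.2 hc)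
  exact ext fun w => key _ c hc h hh w rfl

/-- Differentiating the equation for q gives one for `del b q`, with c + 1 and the shorter right
side `del b f`. Solve that first; the original equation then forces q. -/
theorem exists_smul_add_mul_del [CharZero K] (he : e.LengthLT 2) (hb : del b e = 1) (p c : ℕ)
    (hc : c ≠ 0) {f : ShuffleSeries B K} (hf : f.LengthLT p) :
    ∃ q : ShuffleSeries B K, q.LengthLT p ∧ (c : K) • q + e * del b q = f := by
  have hc' : (c : K) ≠ 0 := Nat.cast_ne_zero.2 hc
  induction p generalizing c f with
  | zero =>
    obtain rfl := hf.eq_zero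
    exact ⟨0, hf, by simp⟩
  | succ p ih =>
    obtain ⟨q, hq, hqf⟩ := ih (c + 1) (Nat.succ_ne_zero c) (hf.del b) (Nat.cast_ne_zero.2 (by omega))
    -- The candidate was built from the expected value of its own derivative; this checks that the
    -- guess is consistent.
    have hd : del b ((c : K)⁻¹ • (f - e * q)) = q := by
      rw [map_smul, map_sub, del_mul, hb, ← hqf, one_mul, Nat.cast_add, Nat.cast_one, add_smul,
        one_smul]
      rw [show (c : K) • q + q + e * del b q - (q + e * del b q) = (c : K) • q by ring,
        inv_smul_smul₀ hc']
    refine ⟨(c : K)⁻¹ • (f - e * q), LengthLT.smul (hf.sub ?_) _, ?_⟩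
    · rcases p with _ | p
      · rw [hq.eq_zero, mul_zero]
        exact fun _ _ => rfl
      · exact (LengthLT.mul he hq).mono (by omega)
    · rw [hd, smul_inv_smul₀ hc', sub_add_cancel]

/-- As `del b e = 1`, the condition on q reads q + e * `del b q` = `del b f`, the case c = 1 of the
equation above. -/
theorem exists_del_sub_mul_eq_zero [CharZero K] (he : e.LengthLT 2) (hb : del b e = 1) {p : ℕ}
    {f : ShuffleSeries B K} (hf : f.LengthLT (p + 1)) :
    ∃ q : ShuffleSeries B K, q.LengthLT p ∧ del b (f - e * q) = 0 := by
  obtain ⟨q, hq, h⟩ := exists_smul_add_mul_del he hb p 1 one_ne_zero (hf.del b)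
  refine ⟨q, hq, ?_⟩
  rw [map_sub, del_mul, hb, ← h, Nat.cast_one, one_smul, one_mul, sub_self]

theorem eq_zero_of_mul_eq_zero [CharZero K] (he : ∀ w, e w ≠ 0 → w.length = 1)
    (hb : del b e = 1) {h : ShuffleSeries B K} (hh : del b (e * h) = 0) : h = 0 := by
  refine eq_zero_of_smul_add_mul_del he 1 one_ne_zero hb ?_
  rw [del_mul, hb, one_mul] at hh
  rwa [Nat.cast_one, one_smul]

/-- A series supported on letters and mapped to `1` by `del b` is prime among the series of
bounded length. -/
theorem exists_mul_eq_or_of_mul_eq [CharZero K] (he : ∀ w, e w ≠ 0 → w.length = 1)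
    (hb : del b e = 1) {p q : ℕ} {f g h : ShuffleSeries B K} (hf : f.LengthLT (p + 1))
    (hg : g.LengthLT (q + 1)) (hfg : f * g = e * h) :
    (∃ f', LengthLT f' p ∧ f = e * f') ∨ ∃ g', LengthLT g' q ∧ g = e * g' := by
  have he2 : e.LengthLT 2 := fun w hw => by
    by_contra h0
    have := he w h0
    omega
  obtain ⟨f', hf', hff⟩ := exists_del_sub_mul_eq_zero he2 hb hf
  obtain ⟨g', hg', hgg⟩ := exists_del_sub_mul_eq_zero he2 hb hg
  have h1 : (f - e * f') * (g - e * g') = e * (h - f' * g - f * g' + e * f' * g') := by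
    linear_combination hfg
  -- The left side of `h1` is a product of two elements killed by a derivation, so it is killed too.
  have h2 : h - f' * g - f * g' + e * f' * g' = 0 := by
    refine eq_zero_of_mul_eq_zero he hb ?_
    rw [← h1, del_mul, hff, hgg, zero_mul, mul_zero, add_zero]
  rw [h2, mul_zero] at h1
  have hlen : ∀ {r : ℕ} {k k' : ShuffleSeries B K}, k.LengthLT (r + 1) → k'.LengthLT r →
      (k - e * k').LengthLT (r + 1) := by
    intro r k k' hk hk'
    refine hk.sub ?_
    rcases r with _ | r
    · rw [hk'.eq_zero, mul_zero]
      exact fun _ _ => rfl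
    · exact (LengthLT.mul he2 hk').mono (by omega)
  by_cases hf0 : f - e * f' = 0
  · exact Or.inl ⟨f', hf', sub_eq_zero.1 hf0⟩
  · by_cases hg0 : g - e * g' = 0
    · exact Or.inr ⟨g', hg', sub_eq_zero.1 hg0⟩
    · exact absurd h1 (mul_ne_zero_of_lengthLT (hlen hf hf') (hlen hg hg') hf0 hg0)

end Prime

end ShuffleSeries

namespace PermAlgebra

/-! ### Elements of `A(G)` as functions on finite sets -/

section Val

variable {Ω : Type*} [DecidableEq Ω] {K : Type*} [Field K] {G : Subgroup (Equiv.Perm Ω)}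

noncomputable instance instCommRingA : CommRing (A K G) := DirectSum.commRing _

/-- An element of `A(G)` read as a function on all finite subsets of `Ω`. -/
def val : A K G →+ (Finset Ω → K) where
  toFun a X := extend (a X.card) X
  map_zero' := funext fun X => extend_zero X
  map_add' a b := funext fun X => extend_add (a X.card) (b X.card) X

theorem val_apply (a : A K G) (X : Finset Ω) : val a X = extend (a X.card) X := rfl

theorem val_of (n : ℕ) (f : V K G n) (X : Finset Ω) :
    val (DirectSum.of (fun n => V K G n) n f) X = extend f X := by
  rw [val_apply]
  by_cases h : n = X.card
  · subst h
    rw [DirectSum.of_eq_same]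
  · rw [DirectSum.of_eq_of_ne _ _ _ (Ne.symm h), extend_zero, extend_of_card_ne f (Ne.symm h)]

theorem val_mul (a b : A K G) (X : Finset Ω) :
    val (a * b) X = ∑ Y ∈ X.powerset, val a Y * val b (X \ Y) := by
  induction a using DirectSum.induction_on with
  | zero => simp
  | add a a' ha ha' =>
    simp only [add_mul,  map_add, Pi.add_apply, ha, ha', Finset.sum_add_distrib]
  | of m f =>
    induction b using DirectSum.induction_on with
    | zero => simp
    | add b b' hb hb' =>
      simp only [mul_add,  map_add, Pi.add_apply, hb, hb', Finset.sum_add_distrib]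
    | of n g =>
      rw [DirectSum.of_mul_of, val_of]
      simp only [val_of]
      exact extend_mul f g X

theorem val_smul (a : A K G) (g : G) (X : Finset Ω) : val a (g • X) = val a X := by
  rw [val_apply, extend_smul_set, Finset.card_smul_finset, val_apply]

theorem val_injective : Function.Injective (val : A K G → Finset Ω → K) := by
  intro a b h
  refine DFinsupp.ext fun n => Subtype.ext (funext fun X => ?_)
  obtain ⟨X, rfl⟩ := X
  have := congrFun h X
  rwa [val_apply, val_apply, extend_of_card _ rfl, extend_of_card _ rfl] at this

theorem exists_val_eq_zero (a : A K G) : ∃ N : ℕ, ∀ X : Finset Ω, N ≤ X.card → val a X = 0 := by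
  induction a using DirectSum.induction_on with
  | zero => exact ⟨0, fun _ _ => by rw [map_zero, Pi.zero_apply]⟩
  | of n f =>
    exact ⟨n + 1, fun X hX => by rw [val_of, extend_of_card_ne f (by omega)]⟩
  | add a b ha hb =>
    obtain ⟨M, hM⟩ := ha
    obtain ⟨N, hN⟩ := hb
    refine ⟨max M N, fun X hX => ?_⟩
    rw [map_add, Pi.add_apply, hM X (le_trans (le_max_left _ _) hX),
      hN X (le_trans (le_max_right _ _) hX), add_zero]

/-- The bound N makes the sum of homogeneous components finite, as a direct sum requires. -/
theorem exists_val_eq {N : ℕ} {F : Finset Ω → K} (hG : ∀ (g : G) (X : Finset Ω), F (g • X) = F X)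
    (hN : ∀ X : Finset Ω, N ≤ X.card → F X = 0) : ∃ a : A K G, val a = F := by
  let f : (n : ℕ) → V K G n := fun n => ⟨fun X => F X.1, fun g X => hG g X.1⟩
  refine ⟨∑ n ∈ Finset.range N, DirectSum.of (fun n => V K G n) n (f n), funext fun X => ?_⟩
  rw [map_sum, Finset.sum_apply]
  simp only [val_of]
  by_cases hX : X.card < N
  · rw [Finset.sum_eq_single_of_mem X.card (Finset.mem_range.2 hX) fun n _ hn =>
      extend_of_card_ne _ hn.symm, extend_of_card _ rfl]
  · rw [hN X (not_lt.1 hX)]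
    exact Finset.sum_eq_zero fun n hn =>
      extend_of_card_ne _ fun h => hX (h ▸ Finset.mem_range.1 hn)

theorem val_ε (X : Finset Ω) : val (ε K G) X = if X.card = 1 then 1 else 0 := by
  rw [ε, val_of, extend]
  rfl

theorem val_one_empty : val (1 : A K G) ∅ = 1 := by
  rw [DirectSum.one_def, val_of]
  exact (extend_const_zero 1 ∅).trans (if_pos rfl)

theorem ε_ne_zero [Nonempty Ω] : ε K G ≠ 0 := by
  obtain ⟨x⟩ := ‹Nonempty Ω›
  intro h
  have := val_ε (K := K) (G := G) {x}
  rw [h, if_pos (Finset.card_singleton x)] at this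
  exact zero_ne_one this

theorem ε_not_isUnit : ¬ IsUnit (ε K G) := by
  rintro ⟨u, hu⟩
  have h := val_one_empty (K := K) (G := G)
  rw [← u.mul_inv, hu, val_mul, Finset.powerset_empty, Finset.sum_singleton, val_ε] at h
  simp at h

end Val

namespace WreathALikeData

/-! ### Words of finite sets and their blocks. -/

section Weight

variable {Ω : Type*} [DecidableEq Ω] {G : Subgroup (Equiv.Perm Ω)} {B : Type*}
  (D : WreathALikeData G B)

/-- The word of a finite set. -/
def wordOf (X : Finset Ω) : List B := D.φ (orbitOf G X)

theorem wordOf_smul (g : G) (X : Finset Ω) : D.wordOf (g • X) = D.wordOf X :=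
  congrArg D.φ (Quotient.sound (MulAction.orbitRel_apply.2 (MulAction.mem_orbit X g)))

theorem wordOf_surjective : Function.Surjective D.wordOf := fun w =>
  ⟨(D.φ.symm w).out, (congrArg D.φ (Quotient.out_eq (D.φ.symm w))).trans (D.φ.apply_symm_apply w)⟩

theorem seqWeight_wordOf (X : Finset Ω) : seqWeight D.wt (D.wordOf X) = X.card := D.weight_eq X

theorem length_le_seqWeight (w : List B) : w.length ≤ seqWeight D.wt w := by
  induction w with
  | nil => exact Nat.zero_le _
  | cons b w ih =>
    have := D.wt_pos b
    simp only [seqWeight, List.map_cons, List.sum_cons, List.length_cons] at ih ⊢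
    omega

theorem length_pos_of_seqWeight_pos {w : List B} (h : 0 < seqWeight D.wt w) : 0 < w.length := by
  rcases w with _ | ⟨b, w⟩
  · simp [seqWeight] at h
  · exact Nat.succ_pos _

theorem length_eq_one_of_seqWeight_eq_one {w : List B} (h : seqWeight D.wt w = 1) : w.length = 1 := by
  have := D.length_le_seqWeight w
  have := D.length_pos_of_seqWeight_pos (h ▸ one_pos)
  omega

theorem eq_nil_of_seqWeight_eq_zero {w : List B} (h : seqWeight D.wt w = 0) : w = [] :=
  List.length_eq_zero_iff.1 (Nat.le_zero.1 (h ▸ D.length_le_seqWeight w))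

/-- The union of a subset of the blocks of a partition. -/
def blockUnion {k : ℕ} (P : Fin k → Finset Ω) (c : Fin k → Bool) : Finset Ω :=
  Finset.univ.biUnion fun l => if c l then P l else ∅

/-- The decomposition of a finite set into its connected blocks: unions of blocks correspond to
subwords, while every other way of splitting the set in two increases the number of letters. -/
theorem exists_blocks (X : Finset Ω) :
    ∃ P : Fin (D.wordOf X).length → Finset Ω,
      Function.Injective (blockUnion P) ∧ (∀ c, blockUnion P c ⊆ X) ∧
      (∀ c, X \ blockUnion P c = blockUnion P fun l => !c l) ∧
      (∀ c, D.wordOf (blockUnion P c) =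
        (List.ofFn fun l => if c l then [(D.wordOf X).get l] else []).flatten) ∧
      ∀ Y ⊆ X, Y ∉ Set.range (blockUnion P) →
        (D.wordOf X).length < (D.wordOf Y).length + (D.wordOf (X \ Y)).length := by
  obtain ⟨P, hdisj, hunion, hcard, hS⟩ := D.decomp X (D.wordOf X) rfl
  have hpos : ∀ l, 0 < (P l).card := fun l => hcard l ▸ D.wt_pos _
  have hmem : ∀ {l x}, x ∈ P l → ∀ c, x ∈ blockUnion P c ↔ c l = true := by
    intro l x hx c
    rw [blockUnion, Finset.mem_biUnion]
    constructor
    · rintro ⟨l', -, h⟩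
      by_cases hc : c l' = true
      · rw [if_pos hc] at h
        by_cases hl : l = l'
        · rwa [hl]
        · exact absurd h (Finset.disjoint_left.1 (hdisj hl) hx)
      · rw [if_neg hc] at h
        exact absurd h (Finset.notMem_empty x)
    · intro hc
      exact ⟨l, Finset.mem_univ l, by rwa [if_pos hc]⟩
  have hX : ∀ {x}, x ∈ X ↔ ∃ l, x ∈ P l := by
    intro x
    refine (Finset.ext_iff.1 hunion x).symm.trans ?_
    simp
  have hsub : ∀ c, blockUnion P c ⊆ X := by
    intro c x hx
    rw [blockUnion, Finset.mem_biUnion] at hx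
    obtain ⟨l, -, h⟩ := hx
    split_ifs at h
    · exact hX.2 ⟨l, h⟩
    · exact absurd h (Finset.notMem_empty x)
  refine ⟨P, ?_, hsub, ?_, ?_, ?_⟩
  · intro c c' h
    funext l
    obtain ⟨x, hx⟩ := Finset.card_pos.1 (hpos l)
    rw [Bool.eq_iff_iff, ← hmem hx, ← hmem hx, h]
  · intro c
    ext x
    rw [Finset.mem_sdiff]
    constructor
    · rintro ⟨hx, hxc⟩
      obtain ⟨l, hl⟩ := hX.1 hx
      rw [hmem hl] at hxc ⊢
      simpa using hxc
    · intro hx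
      have hx' := hsub _ hx
      refine ⟨hx', ?_⟩
      obtain ⟨l, hl⟩ := hX.1 hx'
      rw [hmem hl] at hx ⊢
      simpa using hx
  · intro c
    obtain ⟨S, h1, h2, h3⟩ := hS (fun l => if c l then P l else ∅) fun l => by
      split_ifs
      · exact subset_rfl
      · exact Finset.empty_subset _
    refine h1.trans (congrArg (fun T => (List.ofFn T).flatten) (funext fun l => ?_))
    by_cases hc : c l = true
    · rw [if_pos hc]
      exact h3 l (if_pos hc)
    · rw [if_neg hc]
      refine D.eq_nil_of_seqWeight_eq_zero ((h2 l).trans ?_)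
      rw [if_neg hc, Finset.card_empty]
  · intro Y hY hYP
    obtain ⟨S, hS1, hS2, -⟩ := hS (fun l => Y ∩ P l) fun l => Finset.inter_subset_right
    obtain ⟨T, hT1, hT2, -⟩ := hS (fun l => (X \ Y) ∩ P l) fun l => Finset.inter_subset_right
    rw [← Finset.inter_biUnion, hunion] at hS1 hT1
    rw [Finset.inter_eq_left.2 hY] at hS1
    rw [Finset.inter_eq_left.2 Finset.sdiff_subset] at hT1
    have hlen : ∀ U : Fin (D.wordOf X).length → List B,
        (List.ofFn U).flatten.length = ∑ l, (U l).length := by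
      intro U
      rw [List.length_flatten, List.map_ofFn, List.sum_ofFn]
      rfl
    have hadd : ∀ l, (Y ∩ P l).card + ((X \ Y) ∩ P l).card = (P l).card := by
      intro l
      rw [← Finset.card_union_of_disjoint (Finset.disjoint_of_subset_left Finset.inter_subset_left
        (Finset.disjoint_of_subset_right Finset.inter_subset_left Finset.disjoint_sdiff)),
        ← Finset.union_inter_distrib_right, Finset.union_sdiff_of_subset hY]
      exact congrArg _ (Finset.inter_eq_right.2 fun x hx => hX.2 ⟨l, hx⟩)
    -- A block is nonempty, so it meets Y or its complement and yields at least one letter.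
    have hle : ∀ l, 1 ≤ (S l).length + (T l).length := by
      intro l
      have h1 := hadd l
      have h2 := hpos l
      by_cases h : 0 < (Y ∩ P l).card
      · have := D.length_pos_of_seqWeight_pos (hS2 l ▸ h)
        omega
      · have := D.length_pos_of_seqWeight_pos (w := T l) (by rw [hT2 l]; omega)
        omega
    -- Some block is cut by Y, for otherwise Y would be the union of the blocks inside it. A cut
    -- block yields letters on both sides.
    obtain ⟨l, hl1, hl2⟩ : ∃ l, (Y ∩ P l).Nonempty ∧ ¬ P l ⊆ Y := by
      by_contra! hcon
      classical
      refine hYP ⟨fun l => decide (P l ⊆ Y), ?_⟩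
      ext x
      by_cases hx : x ∈ X
      · obtain ⟨l, hl⟩ := hX.1 hx
        rw [hmem hl, decide_eq_true_iff]
        refine ⟨fun h => h hl, fun h => hcon l ⟨x, Finset.mem_inter.2 ⟨h, hl⟩⟩⟩
      · exact ⟨fun h => absurd (hsub _ h) hx, fun h => absurd (hY h) hx⟩
    have hlt : 1 < (S l).length + (T l).length := by
      have h1 := D.length_pos_of_seqWeight_pos (w := S l)
        (by rw [hS2 l]; exact Finset.card_pos.2 hl1)
      have h2 := D.length_pos_of_seqWeight_pos (w := T l) (by
        rw [hT2 l]
        obtain ⟨x, hx, hxY⟩ := Finset.not_subset.1 hl2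
        exact Finset.card_pos.2 ⟨x, Finset.mem_inter.2
          ⟨Finset.mem_sdiff.2 ⟨hX.2 ⟨l, hx⟩, hxY⟩, hx⟩⟩)
      omega
    have hsum := Finset.sum_lt_sum (fun l _ => hle l) ⟨l, Finset.mem_univ l, hlt⟩
    rw [Finset.sum_add_distrib, ← hlen, ← hlen, ← hS1, ← hT1] at hsum
    rwa [Finset.sum_const, Finset.card_univ, Fintype.card_fin, smul_eq_mul, mul_one] at hsum

end Weight

/-! ### A(G) as a filtered algebra of functions on words, and descent. -/

section Word

open ShuffleSeries

variable {Ω : Type*} [DecidableEq Ω] {K : Type*} [Field K] {G : Subgroup (Equiv.Perm Ω)}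
  {B : Type*} (D : WreathALikeData G B)

/-- An element of `A(G)` read as a function on words. -/
noncomputable def series (a : A K G) : ShuffleSeries B K := fun w => val a (D.φ.symm w).out

theorem series_wordOf (a : A K G) (X : Finset Ω) : D.series a (D.wordOf X) = val a X := by
  rw [series, wordOf, D.φ.symm_apply_apply]
  obtain ⟨g, hg⟩ := MulAction.orbitRel_apply.1
    (Quotient.exact (Quotient.out_eq (s := MulAction.orbitRel G (Finset Ω)) (orbitOf G X)))
  rw [← val_smul a g X]
  exact congrArg _ hg.symm

theorem series_sub (a b : A K G) : D.series (a - b) = D.series a - D.series b :=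
  funext fun w => by
    change val (a - b) _ = val a _ - val b _
    rw [map_sub, Pi.sub_apply]

theorem series_zero : D.series (0 : A K G) = 0 := ext fun _ => congrFun (map_zero val) _

theorem eq_zero_of_series_eq_zero {a : A K G} (h : D.series a = 0) : a = 0 := by
  refine val_injective (funext fun X => ?_)
  rw [← D.series_wordOf, h, map_zero]
  rfl

theorem exists_seqWeight_series_eq_zero (a : A K G) :
    ∃ N, ∀ w, N ≤ seqWeight D.wt w → D.series a w = 0 := by
  obtain ⟨N, hN⟩ := exists_val_eq_zero a
  refine ⟨N, fun w hw => ?_⟩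
  obtain ⟨X, rfl⟩ := D.wordOf_surjective w
  rw [D.series_wordOf]
  exact hN X (D.seqWeight_wordOf X ▸ hw)

/-- The bound is on weight, that is, on the size of sets: bounded length alone would allow
infinitely many nonzero degrees. -/
theorem exists_series_eq {N : ℕ} {q : ShuffleSeries B K}
    (hq : ∀ w, N ≤ seqWeight D.wt w → q w = 0) : ∃ a : A K G, D.series a = q := by
  obtain ⟨a, ha⟩ := exists_val_eq (K := K) (G := G) (N := N) (F := fun X => q (D.wordOf X))
    (fun g X => congrArg q (D.wordOf_smul g X)) fun X hX => hq _ (D.seqWeight_wordOf X ▸ hX)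
  refine ⟨a, funext fun w => ?_⟩
  obtain ⟨X, rfl⟩ := D.wordOf_surjective w
  rw [D.series_wordOf, ha]

theorem exists_lengthLT_series (a : A K G) : ∃ p, (D.series a).LengthLT p := by
  obtain ⟨N, hN⟩ := exists_val_eq_zero a
  refine ⟨N, fun w hw => ?_⟩
  obtain ⟨X, rfl⟩ := D.wordOf_surjective w
  rw [D.series_wordOf]
  exact hN X (hw.trans ((D.length_le_seqWeight _).trans (D.seqWeight_wordOf X).le))

/-- Up to shorter words, the product of `A(G)` is the shuffle product. -/
theorem series_mul_apply {a b : A K G} {p q : ℕ} (ha : (D.series a).LengthLT (p + 1))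
    (hb : (D.series b).LengthLT (q + 1)) {w : List B} (hw : p + q ≤ w.length) :
    D.series (a * b) w = (D.series a * D.series b) w := by
  obtain ⟨X, rfl⟩ := D.wordOf_surjective w
  obtain ⟨P, hinj, hsub, hcompl, hword, hlen⟩ := D.exists_blocks X
  rw [D.series_wordOf, val_mul, mul_apply_eq_sum]
  symm
  refine Finset.sum_of_injOn (blockUnion P) hinj.injOn
    (fun c _ => Finset.mem_coe.2 (Finset.mem_powerset.2 (hsub c))) ?_ ?_
  -- For a splitting that cuts a block, the two words have total length above p + q, so one of them
  -- is too long for its factor.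
  · intro Y hY hYP
    have h := hlen Y (Finset.mem_powerset.1 hY) fun ⟨c, hc⟩ => hYP ⟨c, by simp, hc⟩
    rw [← D.series_wordOf, ← D.series_wordOf b]
    by_cases h1 : p + 1 ≤ (D.wordOf Y).length
    · rw [ha _ h1, zero_mul]
    · rw [hb (D.wordOf (X \ Y)) (by omega), mul_zero]
  · intro c _
    rw [hcompl, ← D.series_wordOf, ← D.series_wordOf b, hword, hword]
    congr 4
    funext l
    cases c l <;> simp

theorem lengthLT_series_mul {a b : A K G} {p q : ℕ} (ha : (D.series a).LengthLT (p + 1))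
    (hb : (D.series b).LengthLT (q + 1)) : (D.series (a * b)).LengthLT (p + q + 1) := fun w hw => by
  rw [D.series_mul_apply ha hb (by omega)]
  exact LengthLT.mul ha hb w hw

theorem series_ε (w : List B) :
    D.series (ε K G) w = if seqWeight D.wt w = 1 then 1 else 0 := by
  obtain ⟨X, rfl⟩ := D.wordOf_surjective w
  rw [D.series_wordOf, val_ε, D.seqWeight_wordOf]

theorem length_of_series_ε_ne_zero {w : List B} (h : D.series (ε K G) w ≠ 0) : w.length = 1 := by
  rw [series_ε] at h
  exact D.length_eq_one_of_seqWeight_eq_one (by_contra fun h' => h (if_neg h'))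

theorem lengthLT_series_ε : (D.series (ε K G)).LengthLT 2 := fun w hw => by
  by_contra h
  have := D.length_of_series_ε_ne_zero h
  omega

/-- The word of a singleton is a single letter b of weight one, and ε vanishes on all words of
length other than one. -/
theorem exists_del_series_ε [Nonempty Ω] : ∃ b : B, del b (D.series (ε K G)) = 1 := by
  obtain ⟨x⟩ := ‹Nonempty Ω›
  have hx := (D.seqWeight_wordOf {x}).trans (Finset.card_singleton x)
  obtain ⟨b, hb⟩ := List.length_eq_one_iff.1 (D.length_eq_one_of_seqWeight_eq_one hx)
  refine ⟨b, ext fun w => ?_⟩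
  rcases w with _ | ⟨b', w⟩
  · rw [del_apply, series_ε, ← hb, if_pos hx, one_nil]
  · rw [del_apply, one_cons]
    by_contra h
    have := D.length_of_series_ε_ne_zero h
    simp at this

/-- Quotients by `ε` in the shuffle algebra can be taken in `A(G)`. -/
theorem exists_series_mul_eq {f q : ShuffleSeries B K} {p N : ℕ}
    (hf : ∀ w, N ≤ seqWeight D.wt w → f w = 0) (hq : q.LengthLT p)
    (hfq : f = D.series (ε K G) * q) :
    ∃ a : A K G, (D.series a).LengthLT p ∧ f = D.series (ε K G) * D.series a := by
  -- The quotient q need not have bounded weight, so it is cut off at weight N.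
  obtain ⟨a, ha⟩ := D.exists_series_eq (K := K) (N := N)
    (q := fun w => if seqWeight D.wt w < N then q w else 0) fun w hw => if_neg (not_lt.2 hw)
  have hε : ∀ {u v w : List B}, (u ++ v).Perm w → D.series (ε K G) u ≠ 0 →
      seqWeight D.wt w = seqWeight D.wt v + 1 := by
    intro u v w huv hu
    rw [series_ε] at hu
    have h1 : seqWeight D.wt u = 1 := by_contra fun h => hu (if_neg h)
    have h2 : seqWeight D.wt (u ++ v) = seqWeight D.wt w := (huv.map D.wt).sum_eq
    have h3 : seqWeight D.wt (u ++ v) = seqWeight D.wt u + seqWeight D.wt v := by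
      simp [seqWeight]
    omega
  replace ha : ∀ w, D.series a w = if seqWeight D.wt w < N then q w else 0 := congrFun ha
  refine ⟨a, fun w hw => ?_, ext fun w => ?_⟩
  · rw [ha, hq w hw, ite_self]
  -- Multiplication by ε raises weight by exactly 1: up to weight N the cut-off is invisible, and
  -- above N both sides vanish.
  · by_cases hw : seqWeight D.wt w ≤ N
    · rw [hfq]
      refine mul_apply_congr fun u v huv => ?_
      by_cases hu : D.series (ε K G) u = 0
      · rw [hu, zero_mul, zero_mul]
      · rw [ha, if_pos (by have := hε huv hu; omega)]
    · rw [hf w (by omega), ← zero_mul_apply w 0]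
      refine mul_apply_congr fun u v huv => ?_
      rw [ShuffleSeries.zero_apply, zero_mul]
      by_cases hu : D.series (ε K G) u = 0
      · rw [hu, zero_mul]
      · rw [ha, if_neg (by have := hε huv hu; omega), mul_zero]

theorem lengthPart_series_ε :
    lengthPart 1 (D.series (ε K G)) = D.series (ε K G) := by
  ext w
  rw [lengthPart_apply]
  split_ifs with h
  · rfl
  · exact by_contra fun h' => h (D.length_of_series_ε_ne_zero (Ne.symm h'))

theorem lengthPart_series_mul {a b : A K G} {p q : ℕ} (ha : (D.series a).LengthLT (p + 1))
    (hb : (D.series b).LengthLT (q + 1)) :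
    lengthPart (p + q) (D.series (a * b)) =
      lengthPart p (D.series a) * lengthPart q (D.series b) := by
  rw [lengthPart_mul_lengthPart ha hb]
  ext w
  rw [lengthPart_apply, lengthPart_apply]
  split_ifs with hw
  · exact D.series_mul_apply ha hb hw.ge
  · rfl

/-- The leading part of ε h is ε times that of h in the shuffle algebra, where ε is not a zero
divisor; so no cancellation can hide a long leading part of h. -/
theorem lengthLT_of_lengthLT_ε_mul [Nonempty Ω] [CharZero K] {h : A K G} {s : ℕ}
    (hs : (D.series (ε K G * h)).LengthLT (s + 1)) : (D.series h).LengthLT s := by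
  obtain ⟨b, hb⟩ := D.exists_del_series_ε (K := K)
  obtain ⟨r, hr⟩ := D.exists_lengthLT_series h
  induction r with
  | zero => exact hr.mono (Nat.zero_le s)
  | succ r ih =>
    by_cases hrs : r + 1 ≤ s
    · exact hr.mono hrs
    refine ih fun w hw => ?_
    have h0 : D.series (ε K G) * lengthPart r (D.series h) = 0 := by
      rw [← D.lengthPart_series_ε, ← D.lengthPart_series_mul D.lengthLT_series_ε hr]
      ext w
      rw [lengthPart_apply]
      split_ifs with hw
      · exact hs w (by omega)
      · rfl
    have h2 := eq_zero_of_mul_eq_zero (fun w => D.length_of_series_ε_ne_zero) hb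
      (h := lengthPart r (D.series h)) (by rw [h0, map_zero])
    by_cases hw' : w.length = r
    · have h3 := lengthPart_apply r (D.series h) w
      rw [h2, if_pos hw'] at h3
      exact h3.symm
    · exact hr w (by omega)

/-- Subtracting a multiple of `ε` lowers the length of an element whose leading part is divisible
by `ε`. -/
theorem exists_lengthLT_sub_mul {a : A K G} {p : ℕ} (ha : (D.series a).LengthLT (p + 1))
    {f : ShuffleSeries B K} (hf : f.LengthLT p)
    (haf : lengthPart p (D.series a) = D.series (ε K G) * f) :
    ∃ c : A K G, (D.series (a - ε K G * c)).LengthLT p := by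
  obtain ⟨N, hN⟩ := D.exists_seqWeight_series_eq_zero a
  obtain ⟨c, hc, hac⟩ := D.exists_series_mul_eq (N := N)
    (fun w hw => by rw [lengthPart_apply, hN w hw, ite_self]) hf haf
  refine ⟨c, fun w hw => ?_⟩
  have h1 : D.series (ε K G * c) w = lengthPart p (D.series a) w := by
    rw [hac]
    rcases p with _ | p
    · rw [D.eq_zero_of_series_eq_zero hc.eq_zero, mul_zero, series_zero, mul_zero]
    · exact D.series_mul_apply D.lengthLT_series_ε hc (by omega)
  rw [series_sub, ShuffleSeries.sub_apply, h1, lengthPart_apply]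
  split_ifs with h
  · exact sub_self _
  · rw [ha w (by omega), sub_zero]

/-- Induction on the sum of the length bounds of a and b. Changing a factor by a multiple of ε
affects neither hypothesis nor conclusion. -/
theorem ε_dvd_or_dvd (D : WreathALikeData G B) [Nonempty Ω] [CharZero K] {a b : A K G} (hab : ε K G ∣ a * b) :
    ε K G ∣ a ∨ ε K G ∣ b := by
  obtain ⟨p, hp⟩ := D.exists_lengthLT_series a
  obtain ⟨q, hq⟩ := D.exists_lengthLT_series b
  induction hn : p + q using Nat.strong_induction_on generalizing a b p q with
  | _ n ih =>
  rcases p with _ | p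
  · rw [D.eq_zero_of_series_eq_zero hp.eq_zero]
    exact Or.inl (dvd_zero _)
  rcases q with _ | q
  · rw [D.eq_zero_of_series_eq_zero hq.eq_zero]
    exact Or.inr (dvd_zero _)
  obtain ⟨h, hh⟩ := id hab
  obtain ⟨e₀, he₀⟩ := D.exists_del_series_ε (K := K)
  -- Without this bound on h, the part of ε h of length p + q would not be ε times a single part of
  -- h.
  have hlen : (D.series h).LengthLT (p + q) :=
    D.lengthLT_of_lengthLT_ε_mul (hh ▸ D.lengthLT_series_mul hp hq)
  have hlead : ∃ k : ShuffleSeries B K,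
      lengthPart p (D.series a) * lengthPart q (D.series b) = D.series (ε K G) * k := by
    rw [← D.lengthPart_series_mul hp hq, hh]
    rcases hpq : p + q with _ | s
    · rw [hpq] at hlen
      rw [D.eq_zero_of_series_eq_zero hlen.eq_zero, mul_zero, series_zero]
      exact ⟨0, ext fun w => (ite_self _).trans (by rw [mul_zero])⟩
    · rw [hpq] at hlen
      exact ⟨lengthPart s (D.series h), by
        rw [add_comm s 1, D.lengthPart_series_mul D.lengthLT_series_ε hlen, lengthPart_series_ε]⟩
  obtain ⟨k, hk⟩ := hlead
  rcases exists_mul_eq_or_of_mul_eq (fun w => D.length_of_series_ε_ne_zero) he₀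
    (lengthLT_lengthPart p _) (lengthLT_lengthPart q _) hk with ⟨f, hf, haf⟩ | ⟨f, hf, hbf⟩
  · obtain ⟨c, hc⟩ := D.exists_lengthLT_sub_mul hp hf haf
    have hd : ε K G ∣ (a - ε K G * c) * b := by
      rw [sub_mul, mul_assoc]
      exact dvd_sub hab (dvd_mul_right _ _)
    refine (ih (p + (q + 1)) (by omega) hd p hc (q + 1) hq rfl).imp_left fun h => ?_
    exact (dvd_sub_left (dvd_mul_right _ _)).1 h
  · obtain ⟨c, hc⟩ := D.exists_lengthLT_sub_mul hq hf hbf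
    have hd : ε K G ∣ a * (b - ε K G * c) := by
      rw [mul_sub, mul_left_comm]
      exact dvd_sub hab (dvd_mul_right _ _)
    refine (ih (p + 1 + q) (by omega) hd (p + 1) hp q hc rfl).imp_right fun h => ?_
    exact (dvd_sub_left (dvd_mul_right _ _)).1 h

end Word

end WreathALikeData

end PermAlgebra

theorem mainTheorem5 {Ω : Type*} [Nonempty Ω] [DecidableEq Ω] (K : Type*) [Field K] [CharZero K]
    (G : Subgroup (Equiv.Perm Ω)) (hO : PermAlgebra.IsOligomorphic G)
    (hW : PermAlgebra.IsWreathALike G) :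
    Prime (PermAlgebra.ε K G) := by
  obtain ⟨B, ⟨D⟩⟩ := hW
  exact ⟨PermAlgebra.ε_ne_zero, PermAlgebra.ε_not_isUnit, fun a b => D.ε_dvd_or_dvd⟩
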